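/- Let $n\ge 1$. Let $\mathrm{Av}^\star_{3n}(321)$ be the set of permutations $\pi=\pi_1\pi_2\cdots\pi_{3n}$ of $[3n]=\{1,\dots,3n\}$ whose cycle decomposition consists only of $3$-cycles and which avoid the pattern $321$, i.e. there are no indices $a<b<c$ with $\pi_a>\pi_b>\pi_c$. Let $\mathcal T_n$ be the set of all $n$-element subsets $T=\{t_1<t_2<\dots<t_n\}$ of $[3n]$ with $t_i\le 3i-2$ for every $1\le i\le n$. For a word $V$ on the alphabet $\{x,y,z\}$ let $X(V)$ and $Y(V)$ denote the numbers of $x$'s and $y$'s in $V$. For $T\in\mathcal T_n$ define the word $W(T)=w_1w_2\cdots w_{3n}$ letter by letter: having defined $V=w_1\cdots w_{k-1}$, - if $k\in T$, put $w_k=z$; - if $k\notin T$ and $X(V)=Y(V)$, put $w_k=x$; - if $k\notin T$ and $X(V)\neq Y(V)$ (in which case $X(V)>Y(V)$), let $j$ be the number of $z$'s that occur in $V$ before its $(Y(V)+1)$-st $x$; put $w_k=y$ if $j=X(V)$, and $w_k=x$ otherwise. For $1\le i\le Y(W(T))$ let $W^{(i)}$ be the initial segment of $W=W(T)$ that ends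 with the $i$-th occurrence of $y$, and let $h(T)$ be the number of indices $i$ with $X(W^{(i)})=i$. Then $$|\mathrm{Av}^\star_{3n}(321)|=\sum_{T\in\mathcal T_n}2^{h(T)}.$$ -/

import Mathlib

namespace ThreeCycles

/-- The permutation `π` (in one-line notation) contains the pattern `σ`: some subsequence of `π`
is in the same relative order as `σ`. -/
def ContainsPattern {k m : ℕ} (σ : Equiv.Perm (Fin k)) (π : Equiv.Perm (Fin m)) : Prop :=
  ∃ f : Fin k → Fin m, StrictMono f ∧ ∀ a b, π (f a) < π (f b) ↔ σ a < σ b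

/-- `π` avoids the pattern `σ`. -/
def Avoids {k m : ℕ} (π : Equiv.Perm (Fin m)) (σ : Equiv.Perm (Fin k)) : Prop :=
  ¬ ContainsPattern σ π

/-- The pattern `321`, i.e. the order-reversing permutation of three points. -/
def pattern321 : Equiv.Perm (Fin 3) := Fin.revPerm

/-- The permutations of `3n` points whose cycle decomposition consists of `n` three-cycles
(hence without fixed points) and which avoid the pattern `σ`. -/
def AvStar (n : ℕ) {k : ℕ} (σ : Equiv.Perm (Fin k)) : Set (Equiv.Perm (Fin (3 * n))) :=
  {π | π.cycleType = Multiset.replicate n 3 ∧ Avoids π σ}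

/-- The `n`-element subsets `t₁ < ⋯ < tₙ` of `{1, …, 3n}` with `tᵢ ≤ 3i - 2` for all `i`.
The index `i : Fin n` starts at `0`, so it stands for the mathematical index `i + 1`. -/
def TSets (n : ℕ) : Finset (Finset ℕ) :=
  ((Finset.Icc 1 (3 * n)).powersetCard n).filter fun T =>
    ∃ h : T.card = n, ∀ i : Fin n, T.orderEmbOfFin h i + 2 ≤ 3 * ((i : ℕ) + 1)

/-- The alphabet `{x, y, z}`. -/
inductive Letter
  | x
  | y
  | z
  deriving DecidableEq

/-- The number of `x`'s in a word. -/
def X (w : List Letter) : ℕ := w.count Letter.x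

/-- The number of `y`'s in a word. -/
def Y (w : List Letter) : ℕ := w.count Letter.y

/-- The initial part of a word up to and including the `i`-th occurrence of the letter `a`
(`i ≥ 1`); it is only used when there are at least `i` occurrences. -/
def throughNth (a : Letter) : ℕ → List Letter → List Letter
  | 0, _ => []
  | _ + 1, [] => []
  | i + 1, b :: w => b :: (if b = a then throughNth a i w else throughNth a (i + 1) w)

/-- The number of `z`'s before the `i`-th `x` of a word. -/
def zBeforeX (w : List Letter) (i : ℕ) : ℕ := (throughNth Letter.x i w).count Letter.z

/-- The letter in position `k` (positions start at `1`), given the word `w` formed by the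
letters in positions `1, …, k - 1`. -/
def nextLetter (T : Finset ℕ) (k : ℕ) (w : List Letter) : Letter :=
  if k ∈ T then Letter.z
  else if X w = Y w then Letter.x
  else if zBeforeX w (Y w + 1) = X w then Letter.y
  else Letter.x

/-- The first `k` letters of the word determined by `T`. -/
def wordPrefix (T : Finset ℕ) : ℕ → List Letter
  | 0 => []
  | k + 1 => wordPrefix T k ++ [nextLetter T (k + 1) (wordPrefix T k)]

/-- The word `W(T)` of length `3n`. -/
def W (n : ℕ) (T : Finset ℕ) : List Letter := wordPrefix T (3 * n)

/-- The `i`-th initial segment of a word: it ends with the `i`-th `y`. -/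
def initialSegment (w : List Letter) (i : ℕ) : List Letter := throughNth Letter.y i w

/-- The number of indices `i` (among those for which there is an `i`-th `y`) such that the `i`-th
initial segment of `W(T)` contains exactly `i` letters `x`. -/
def h (n : ℕ) (T : Finset ℕ) : ℕ :=
  ((Finset.Icc 1 (Y (W n T))).filter fun i => X (initialSegment (W n T) i) = i).card

end ThreeCycles

/-! Write the cycles as triples a_i < b_i < c_i, sorted by minima. Avoiding 321 means increasing on
excedances and on deficiencies (`avoids_pattern321_iff_monotone`). This forces medians and maxima
into the order of the minima, gives a_i < b_j ⇔ b_i < c_j, and puts c_i below b_j when cycles i < j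
turn in opposite directions; conversely these conditions suffice. Hence a permutation is a
configuration with an orientation constant on blocks of linked intervals [b_i, c_i], and a
configuration with m blocks carries 2^m permutations (`ncard_isOrientation`, `ncard_fiber`).

A configuration is determined by its minima (`unique`), and W(T) builds it from left to right: z, x,
y mark minima, medians, maxima. The link condition says that the z's before the j-th x are as many
as the x's before the j-th y, which is the rule choosing between x and y. The bound t_i ≤ 3i - 2 is
necessary (`le_three_mul`) and keeps the rule from getting stuck (`letterCount_invariant`). The i-th
y closes a block iff exactly i x's precede it, so h(T) counts blocks; summing over sets of minima
gives the theorem. -/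

namespace ThreeCycles

/-! ### Configurations and orientations -/

/-- The `i`-th triple `a i < b i < c i` is the support of the `i`-th three-cycle. -/
structure IsConfig {n : ℕ} {α : Type*} [LinearOrder α] (a b c : Fin n → α) : Prop where
  a_mono : StrictMono a
  b_mono : StrictMono b
  c_mono : StrictMono c
  a_lt_b : ∀ i, a i < b i
  b_lt_c : ∀ i, b i < c i
  lt_iff : ∀ i j, a i < b j ↔ b i < c j
  a_ne_b : ∀ i j, a i ≠ b j
  a_ne_c : ∀ i j, a i ≠ c j
  b_ne_c : ∀ i j, b i ≠ c j
  cover : ∀ k, (∃ i, a i = k) ∨ (∃ i, b i = k) ∨ ∃ i, c i = k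

/-- Orientations of the cycles such that cycles of opposite orientations have disjoint
intervals `[b i, c i]`. -/
def IsOrientation {n : ℕ} {α : Type*} [LinearOrder α] (b c : Fin n → α) (s : Fin n → Bool) : Prop :=
  ∀ i j, i < j → s i ≠ s j → c i < b j

/-- The permutation `π` cycles `a i → b i → c i` if `s i`, and `a i → c i → b i` otherwise. -/
def Realizes {n : ℕ} {α : Type*} (a b c : Fin n → α) (s : Fin n → Bool) (π : Equiv.Perm α) : Prop :=
  ∀ i, if s i then π (a i) = b i ∧ π (b i) = c i ∧ π (c i) = a i
    else π (a i) = c i ∧ π (c i) = b i ∧ π (b i) = a i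

/-! ### Cycle type and 321-avoidance -/

theorem cycleType_eq_replicate_three_iff {n : ℕ} (π : Equiv.Perm (Fin (3 * n))) :
    π.cycleType = Multiset.replicate n 3 ↔ (∀ p, π (π (π p)) = p) ∧ ∀ p, π p ≠ p := by
  constructor
  · intro h
    have h1 : orderOf π ∣ 3 := by
      rw [← Equiv.Perm.lcm_cycleType, h, Multiset.lcm_dvd]
      intro b hb
      rw [Multiset.eq_of_mem_replicate hb]
    have h3 : π ^ 3 = 1 := orderOf_dvd_iff_pow_eq_one.1 h1
    have h2 : π.support = Finset.univ := by
      rw [← Finset.card_eq_iff_eq_univ, ← Equiv.Perm.sum_cycleType, h]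
      simp [mul_comm]
    refine ⟨fun p => by simpa [pow_succ] using congrArg (fun σ => σ p) h3, fun p => ?_⟩
    rw [← Equiv.Perm.mem_support, h2]
    exact Finset.mem_univ p
  · rintro ⟨h3, hf⟩
    have h3' : π ^ 3 = 1 := by
      ext p
      simp [pow_succ, h3]
    have hsupp : π.support = Finset.univ := by
      ext p
      simp [hf]
    have hall : ∀ m ∈ π.cycleType, m = 3 := by
      intro m hm
      have h1 : m ∣ 3 := (Equiv.Perm.dvd_of_mem_cycleType hm).trans (orderOf_dvd_of_pow_eq_one h3')
      have h2 := Equiv.Perm.two_le_of_mem_cycleType hm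
      rcases (Nat.dvd_prime Nat.prime_three).1 h1 with h | h <;> omega
    have hrep := Multiset.eq_replicate_card.2 hall
    have hsum := Equiv.Perm.sum_cycleType π
    rw [hrep, hsupp] at hsum
    simp at hsum
    rw [hrep, show π.cycleType.card = n by omega]

theorem avoids_pattern321_iff {m : ℕ} (π : Equiv.Perm (Fin m)) :
    Avoids π pattern321 ↔ ∀ i j k, i < j → j < k → π j < π i → ¬ π k < π j := by
  unfold Avoids ContainsPattern
  constructor
  · intro h i j k hij hjk h1 h2
    refine h ⟨![i, j, k], ?_, ?_⟩
    · rw [Fin.strictMono_iff_lt_succ]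
      intro r
      fin_cases r
      · exact hij
      · exact hjk
    · have h3 := h2.trans h1
      intro r t
      fin_cases r <;> fin_cases t <;>
        simp [pattern321, h1, h2, h3, h1.le, h2.le, h3.le]
  · rintro h ⟨f, hf, hp⟩
    refine h (f 0) (f 1) (f 2) (hf (by decide)) (hf (by decide)) ?_ ?_
    · rw [hp]; decide
    · rw [hp]; decide

/-- A fixed-point-free permutation of order three avoids `321` iff it is increasing on its
excedances and on its deficiencies. -/
theorem avoids_pattern321_iff_monotone {m : ℕ} (π : Equiv.Perm (Fin m))
    (h3 : ∀ p, π (π (π p)) = p) (hf : ∀ p, π p ≠ p) :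
    Avoids π pattern321 ↔ (∀ p q, p < q → p < π p → q < π q → π p < π q) ∧
      ∀ p q, p < q → π p < p → π q < q → π p < π q := by
  rw [avoids_pattern321_iff]
  constructor
  · intro h
    constructor
    · intro p q hpq hp hq
      by_contra hlt
      have hne : π q < π p := lt_of_le_of_ne (not_lt.1 hlt) (fun e => hpq.ne' (π.injective e))
      -- The third entry of a 321 comes from the cycle of `q`: position `π q` if it is a deficiency,
      -- otherwise `π (π q)`, whose value is `q`.
      rcases lt_or_ge (π (π q)) (π q) with h1 | h1
      · exact h p q (π q) hpq hq hne h1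
      · refine h p q (π (π q)) hpq (hq.trans_le h1) hne ?_
        rw [h3]; exact hq
    · intro p q hpq hp hq
      by_contra hlt
      have hne : π q < π p := lt_of_le_of_ne (not_lt.1 hlt) (fun e => hpq.ne' (π.injective e))
      rcases lt_or_ge (π p) (π (π p)) with h1 | h1
      · exact h (π p) p q hp hpq h1 hne
      · refine h (π (π p)) p q (h1.trans_lt hp) hpq ?_ hne
        rw [h3]; exact hp
  · rintro ⟨hE, hD⟩ i j k hij hjk h1 h2
    -- A deficient middle entry makes the last entry deficient; an excedance in the middle makes the
    -- first one an excedance.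
    rcases lt_or_gt_of_ne (hf j) with hj | hj
    · exact absurd (hD j k hjk hj (h2.trans (hj.trans hjk))) h2.asymm
    · exact absurd (hE i j hij (hij.trans (hj.trans h1)) hj) h1.asymm

/-! ### From configurations to permutations -/

namespace IsConfig

variable {n : ℕ} {α : Type*} [LinearOrder α] {a b c : Fin n → α}

theorem bijective (hC : IsConfig a b c) :
    Function.Bijective (fun q : Fin n × Fin 3 => (![a, b, c] q.2) q.1) := by
  constructor
  · rintro ⟨i, r⟩ ⟨j, t⟩ h
    have ha := hC.a_mono.injective
    have hb := hC.b_mono.injective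
    have hc := hC.c_mono.injective
    fin_cases r <;> fin_cases t <;> simp at h ⊢
    · exact ha h
    · exact absurd h (hC.a_ne_b _ _)
    · exact absurd h (hC.a_ne_c _ _)
    · exact absurd h.symm (hC.a_ne_b _ _)
    · exact hb h
    · exact absurd h (hC.b_ne_c _ _)
    · exact absurd h.symm (hC.a_ne_c _ _)
    · exact absurd h.symm (hC.b_ne_c _ _)
    · exact hc h
  · intro k
    rcases hC.cover k with ⟨i, h⟩ | ⟨i, h⟩ | ⟨i, h⟩
    · exact ⟨(i, 0), h⟩
    · exact ⟨(i, 1), h⟩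
    · exact ⟨(i, 2), h⟩

theorem exists_realizes (hC : IsConfig a b c) (s : Fin n → Bool) :
    ∃ π : Equiv.Perm α, Realizes a b c s π := by
  let e := Equiv.ofBijective _ hC.bijective
  -- Minimum, median, maximum are 0, 1, 2, so the two orientations are rotations by 1 and 2 modulo
  -- 3.
  let ρ : Equiv.Perm (Fin n × Fin 3) :=
    { toFun := fun q => (q.1, if s q.1 then q.2 + 1 else q.2 + 2)
      invFun := fun q => (q.1, if s q.1 then q.2 + 2 else q.2 + 1)
      left_inv := by
        rintro ⟨i, r⟩
        by_cases h : s i <;> simp [h, add_assoc]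
      right_inv := by
        rintro ⟨i, r⟩
        by_cases h : s i <;> simp [h, add_assoc] }
  have key : ∀ i r, (e.permCongr ρ) ((![a, b, c] r) i) = e (ρ (i, r)) := by
    intro i r
    have : (![a, b, c] r) i = e (i, r) := rfl
    rw [this, Equiv.permCongr_apply, Equiv.symm_apply_apply]
  refine ⟨e.permCongr ρ, fun i => ?_⟩
  have ha := key i 0
  have hb := key i 1
  have hc := key i 2
  by_cases h : s i
  · rw [if_pos h]
    simp only [ρ, Equiv.coe_fn_mk, h, if_true] at ha hb hc
    exact ⟨ha, hb, hc⟩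
  · rw [if_neg h]
    simp only [ρ, Equiv.coe_fn_mk, h] at ha hb hc
    exact ⟨ha, hc, hb⟩

theorem realizes_unique_perm (hC : IsConfig a b c) {s : Fin n → Bool} {π σ : Equiv.Perm α}
    (hπ : Realizes a b c s π) (hσ : Realizes a b c s σ) : π = σ := by
  ext k
  rcases hC.cover k with ⟨i, rfl⟩ | ⟨i, rfl⟩ | ⟨i, rfl⟩ <;>
  · have h1 := hπ i
    have h2 := hσ i
    split_ifs at h1 h2 <;> simp [h1, h2]

theorem realizes_unique_orientation (hC : IsConfig a b c) {s t : Fin n → Bool} {π : Equiv.Perm α}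
    (hs : Realizes a b c s π) (ht : Realizes a b c t π) : s = t := by
  ext i
  have h1 := hs i
  have h2 := ht i
  have h3 := hC.b_ne_c i i
  cases h : s i <;> cases h' : t i <;>
    simp only [h, h', if_true, Bool.false_eq_true, if_false] at h1 h2
  · rfl
  · exact absurd (h2.1.symm.trans h1.1) h3
  · exact absurd (h1.1.symm.trans h2.1) h3
  · rfl

theorem realizes_min_iff (hC : IsConfig a b c) {s : Fin n → Bool} {π : Equiv.Perm α}
    (hs : Realizes a b c s π) (p : α) : (p < π p ∧ p < π (π p)) ↔ ∃ i, a i = p := by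
  rcases hC.cover p with ⟨i, rfl⟩ | ⟨i, rfl⟩ | ⟨i, rfl⟩ <;>
  · have h1 := hs i
    have hab := hC.a_lt_b i
    have hbc := hC.b_lt_c i
    have hac := hab.trans hbc
    have e1 := hC.a_ne_b
    have e2 := hC.a_ne_c
    split_ifs at h1 <;> obtain ⟨h, h', h''⟩ := h1 <;> simp_all [le_of_lt]

theorem mem_avStar {a b c : Fin n → Fin (3 * n)} (hC : IsConfig a b c) {s : Fin n → Bool}
    {π : Equiv.Perm (Fin (3 * n))} (hO : IsOrientation b c s) (hs : Realizes a b c s π) :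
    π ∈ AvStar n pattern321 := by
  have h3 : ∀ p, π (π (π p)) = p := by
    intro p
    rcases hC.cover p with ⟨i, rfl⟩ | ⟨i, rfl⟩ | ⟨i, rfl⟩ <;>
    · have h1 := hs i
      split_ifs at h1 <;> simp [h1]
  have hf : ∀ p, π p ≠ p := by
    intro p
    rcases hC.cover p with ⟨i, rfl⟩ | ⟨i, rfl⟩ | ⟨i, rfl⟩ <;>
    · have h1 := hs i
      have hab := hC.a_lt_b i
      have hbc := hC.b_lt_c i
      have hac := hab.trans hbc
      split_ifs at h1 <;> simp [h1, hab.ne, hbc.ne, hac.ne, hab.ne', hbc.ne', hac.ne']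
  refine ⟨(cycleType_eq_replicate_three_iff π).2 ⟨h3, hf⟩,
    (avoids_pattern321_iff_monotone π h3 hf).2 ?_⟩
  have key : ∀ i j p q, (p = a i ∨ p = b i ∨ p = c i) → (q = a j ∨ q = b j ∨ q = c j) →
      p < q → (p < π p → q < π q → π p < π q) ∧ (π p < p → π q < q → π p < π q) := by
    intro i j p q hp hq hpq
    have h1 := hs i
    have h2 := hs j
    have l1 := hC.a_lt_b i
    have l2 := hC.b_lt_c i
    have l3 := hC.a_lt_b j
    have l4 := hC.b_lt_c j
    have m1 := hC.lt_iff i j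
    have m2 := hC.lt_iff j i
    have n1 := hC.a_ne_b i j
    have n2 := hC.a_ne_b j i
    have n3 := hC.b_ne_c i j
    have n4 := hC.b_ne_c j i
    have ord : (a i < a j ∧ b i < b j ∧ c i < c j ∧ (s i ≠ s j → c i < b j)) ∨
        (a i = a j ∧ b i = b j ∧ c i = c j ∧ s i = s j) ∨
        (a j < a i ∧ b j < b i ∧ c j < c i ∧ (s i ≠ s j → c j < b i)) := by
      rcases lt_trichotomy i j with hij | rfl | hij
      · exact Or.inl ⟨hC.a_mono hij, hC.b_mono hij, hC.c_mono hij, hO i j hij⟩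
      · simp
      · exact Or.inr (Or.inr ⟨hC.a_mono hij, hC.b_mono hij, hC.c_mono hij,
          fun h => hO j i hij h.symm⟩)
    simp only [Fin.lt_def, Fin.ext_iff, ne_eq] at hpq l1 l2 l3 l4 m1 m2 n1 n2 n3 n4 ord ⊢
    cases hsi : s i <;> cases hsj : s j <;>
      simp [hsi, hsj, Fin.ext_iff] at h1 h2 ord <;>
      obtain ⟨h1, h1', h1''⟩ := h1 <;> obtain ⟨h2, h2', h2''⟩ := h2 <;>
      rcases hp with rfl | rfl | rfl <;> rcases hq with rfl | rfl | rfl <;> omega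
  have cov : ∀ p, ∃ i, p = a i ∨ p = b i ∨ p = c i := by
    intro p
    rcases hC.cover p with ⟨i, h⟩ | ⟨i, h⟩ | ⟨i, h⟩ <;> exact ⟨i, by simp [h]⟩
  constructor <;> intro p q hpq <;> obtain ⟨i, hi⟩ := cov p <;> obtain ⟨j, hj⟩ := cov q
  · exact (key i j p q hi hj hpq).1
  · exact (key i j p q hi hj hpq).2

end IsConfig

/-! ### From permutations to configurations -/

theorem exists_isConfig_of_mem_avStar {n : ℕ} {π : Equiv.Perm (Fin (3 * n))}
    (hπ : π ∈ AvStar n pattern321) : ∃ (a b c : Fin n → Fin (3 * n)) (s : Fin n → Bool),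
      IsConfig a b c ∧ IsOrientation b c s ∧ Realizes a b c s π := by
  obtain ⟨h3, hf⟩ := (cycleType_eq_replicate_three_iff π).1 hπ.1
  obtain ⟨hE, hD⟩ := (avoids_pattern321_iff_monotone π h3 hf).1 hπ.2
  have hf2 : ∀ p, π (π p) ≠ p := fun p h => hf p (by have := h3 p; rwa [h] at this)
  let A : Finset (Fin (3 * n)) := {p | p < π p ∧ p < π (π p)}
  have memA : ∀ p, p ∈ A ↔ p < π p ∧ p < π (π p) := fun p => by simp [A]
  -- Each point is uniquely an iterate of the minimum of its cycle, so there are `n` minima.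
  let g : A × Fin 3 → Fin (3 * n) := fun q => ![(q.1 : Fin (3 * n)), π q.1, π (π q.1)] q.2
  have hg : Function.Bijective g := by
    constructor
    · rintro ⟨⟨p, hp⟩, r⟩ ⟨⟨q, hq⟩, t⟩ h
      rw [memA] at hp hq
      have hp3 := h3 p
      have hq3 := h3 q
      fin_cases r <;> fin_cases t <;> simp [g] at h ⊢ <;> grind
    · intro p
      have hp3 := h3 p
      have h1 := hf p
      have h2 := hf2 p
      have h4 := hf (π p)
      have : p ∈ A ∨ π p ∈ A ∨ π (π p) ∈ A := by
        simp only [memA, h3]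
        simp only [Fin.lt_def, Fin.ext_iff, ne_eq] at *
        omega
      rcases this with h | h | h
      · exact ⟨(⟨p, h⟩, 0), rfl⟩
      · exact ⟨(⟨_, h⟩, 2), hp3⟩
      · exact ⟨(⟨_, h⟩, 1), hp3⟩
  have hcard : A.card = n := by
    have := Fintype.card_of_bijective hg
    simp at this
    omega
  let a : Fin n → Fin (3 * n) := A.orderEmbOfFin hcard
  have a_mem : ∀ i, a i ∈ A := A.orderEmbOfFin_mem hcard
  have a_mono : StrictMono a := (A.orderEmbOfFin hcard).strictMono
  have a_surj : ∀ p ∈ A, ∃ i, a i = p := fun p hp => by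
    have : p ∈ Set.range (A.orderEmbOfFin hcard) := by rw [Finset.range_orderEmbOfFin]; exact hp
    exact this
  let b : Fin n → Fin (3 * n) := fun i => min (π (a i)) (π (π (a i)))
  let c : Fin n → Fin (3 * n) := fun i => max (π (a i)) (π (π (a i)))
  let s : Fin n → Bool := fun i => decide (π (a i) < π (π (a i)))
  have hs : Realizes a b c s π := by
    intro i
    by_cases h : π (a i) < π (π (a i))
    · simp [s, b, c, h, h.le, h3]
    · simp [s, b, c, h, not_lt.1 h, h3]
  have a_lt_b : ∀ i, a i < b i := fun i => lt_min ((memA _).1 (a_mem i)).1 ((memA _).1 (a_mem i)).2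
  have b_lt_c : ∀ i, b i < c i := fun i => min_lt_max.2 (hf _).symm
  -- Strict monotonicity also reflects order, so comparisons transfer to images and back.
  have hEE : ∀ {p q u v}, π p = u → π q = v → p < u → q < v → (p < q ↔ u < v) := by
    rintro p q _ _ rfl rfl hp hq
    refine ⟨fun h => hE p q h hp hq, fun h => ?_⟩
    rcases lt_trichotomy p q with h' | rfl | h'
    · exact h'
    · exact absurd h (lt_irrefl _)
    · exact absurd h (hE q p h' hq hp).asymm
  have hDD : ∀ {p q u v}, π p = u → π q = v → u < p → v < q → (p < q ↔ u < v) := by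
    rintro p q _ _ rfl rfl hp hq
    refine ⟨fun h => hD p q h hp hq, fun h => ?_⟩
    rcases lt_trichotomy p q with h' | rfl | h'
    · exact h'
    · exact absurd h (lt_irrefl _)
    · exact absurd h (hD q p h' hq hp).asymm
  have same_cycle : ∀ i j p, (p = a i ∨ p = b i ∨ p = c i) → (p = a j ∨ p = b j ∨ p = c j) →
      i = j := by
    have hmem : ∀ i p, (p = a i ∨ p = b i ∨ p = c i) → ∃ r, p = g (⟨a i, a_mem i⟩, r) := by
      rintro i p hp
      rcases hp with rfl | rfl | rfl
      · exact ⟨0, rfl⟩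
      · rcases min_choice (π (a i)) (π (π (a i))) with h | h
        · exact ⟨1, h⟩
        · exact ⟨2, h⟩
      · rcases max_choice (π (a i)) (π (π (a i))) with h | h
        · exact ⟨1, h⟩
        · exact ⟨2, h⟩
    intro i j p hi hj
    obtain ⟨r, hr⟩ := hmem i p hi
    obtain ⟨t, ht⟩ := hmem j p hj
    have := hg.1 (hr.symm.trans ht)
    simp only [Prod.mk.injEq, Subtype.mk.injEq] at this
    exact a_mono.injective this.1
  have ne_b : ∀ i j, a i ≠ b j := by
    intro i j h
    have := same_cycle i j (a i) (by simp) (by simp [h])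
    subst this
    exact (a_lt_b i).ne h
  have ne_c : ∀ i j, b i ≠ c j := by
    intro i j h
    have := same_cycle i j (b i) (by simp) (by simp [h])
    subst this
    exact (b_lt_c i).ne h
  have pair : ∀ i j, i < j → b i < b j ∧ c i < c j ∧ (a i < b j ↔ b i < c j) ∧
      (a j < b i ↔ b j < c i) ∧ (s i ≠ s j → c i < b j) := by
    intro i j hij
    have ha := a_mono hij
    have h1 := hs i
    have h2 := hs j
    have l1 := a_lt_b i
    have l2 := b_lt_c i
    have l3 := a_lt_b j
    have l4 := b_lt_c j
    have l5 := l1.trans l2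
    have l6 := l3.trans l4
    -- For opposite orientations, `c i < b j` is the image or the preimage of `a i < a j` under `π`.
    cases hsi : s i <;> cases hsj : s j <;>
      simp only [hsi, hsj, if_true, Bool.false_eq_true, if_false] at h1 h2 <;>
      obtain ⟨h1, h1', h1''⟩ := h1 <;> obtain ⟨h2, h2', h2''⟩ := h2
    · have f1 := hEE h1 h2 l5 l6
      have f2 := hDD h1' h2' l2 l4
      have f3 := hDD h1' h2'' l2 l3
      have f4 := hDD h1'' h2' l1 l4
      have f5 := hDD h1'' h2'' l1 l3
      have n1 := ne_b i j
      have n2 := ne_b j i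
      have n3 := ne_c i j
      have n4 := ne_c j i
      simp only [Fin.lt_def, Fin.ext_iff, ne_eq, not_true, false_implies, and_true] at *
      omega
    · have f1 := hEE h1 h2 l5 l3
      have f2 := hEE h1 h2' l5 l4
      have f3 := hDD h1' h2'' l2 l6
      have f4 := hDD h1'' h2'' l1 l6
      have n1 := ne_b i j
      have n2 := ne_b j i
      have n3 := ne_c i j
      have n4 := ne_c j i
      simp only [Fin.lt_def, Fin.ext_iff, ne_eq, reduceCtorEq, not_false_iff, true_implies] at *
      omega
    · have f1 := hEE h1 h2 l1 l6
      have f2 := hEE h1' h2 l2 l6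
      have f3 := hDD h1'' h2' l5 l4
      have f4 := hDD h1'' h2'' l5 l3
      have n1 := ne_b i j
      have n2 := ne_b j i
      have n3 := ne_c i j
      have n4 := ne_c j i
      simp only [Fin.lt_def, Fin.ext_iff, ne_eq, reduceCtorEq, not_false_iff, true_implies] at *
      omega
    · have f1 := hEE h1 h2 l1 l3
      have f2 := hEE h1 h2' l1 l4
      have f3 := hEE h1' h2 l2 l3
      have f4 := hEE h1' h2' l2 l4
      have f5 := hDD h1'' h2'' l5 l6
      have n1 := ne_b i j
      have n2 := ne_b j i
      have n3 := ne_c i j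
      have n4 := ne_c j i
      simp only [Fin.lt_def, Fin.ext_iff, ne_eq, not_true, false_implies, and_true] at *
      omega
  refine ⟨a, b, c, s, ⟨a_mono, fun i j h => (pair i j h).1, fun i j h => (pair i j h).2.1, a_lt_b,
    b_lt_c, fun i j => ?_, ne_b, ?_, ne_c, fun k => ?_⟩, fun i j h => (pair i j h).2.2.2.2, hs⟩
  · rcases lt_trichotomy i j with h | rfl | h
    · exact (pair i j h).2.2.1
    · simp [a_lt_b, b_lt_c]
    · exact (pair j i h).2.2.2.1
  · intro i j h
    have := same_cycle i j (a i) (by simp) (by simp [h])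
    subst this
    exact ((a_lt_b i).trans (b_lt_c i)).ne h
  · obtain ⟨⟨⟨p, hp⟩, r⟩, rfl⟩ := hg.2 k
    obtain ⟨i, rfl⟩ := a_surj p hp
    have h1 := hs i
    split_ifs at h1 <;> obtain ⟨h, h', h''⟩ := h1 <;> fin_cases r <;> simp [g, h, h']

end ThreeCycles

namespace ThreeCycles

/-! ### Minima determine the configuration -/

namespace IsConfig

variable {n : ℕ} {α : Type*} [LinearOrder α] {a b c b' c' : Fin n → α}

/-- The medians of a configuration at a point, given its minima, are determined by the part of
the configuration below that point. -/
theorem b_eq_of_below (hC : IsConfig a b c) (hC' : IsConfig a b' c') {k : α}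
    (ih : ∀ m < k, ∀ i, (b i = m ↔ b' i = m) ∧ (c i = m ↔ c' i = m)) {i : Fin n} (hi : b i = k) :
    b' i = k := by
  rcases hC'.cover k with ⟨j, hj⟩ | ⟨j, hj⟩ | ⟨j, hj⟩
  · exact absurd (hj.trans hi.symm) (hC.a_ne_b j i)
  · rcases lt_trichotomy i j with h | rfl | h
    · have h1 : b' i < k := hj ▸ hC'.b_mono h
      exact absurd (hi ▸ ((ih _ h1 i).1.2 rfl)) h1.ne'
    · exact hj
    · have h1 : b j < k := hi ▸ hC.b_mono h
      exact absurd (hj ▸ ((ih _ h1 j).1.1 rfl)) h1.ne'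
  · rcases lt_trichotomy (b' i) k with h | h | h
    · exact absurd (hi ▸ ((ih _ h i).1.2 rfl)) h.ne'
    · exact h
    · have h1 : ¬ a i < b' j := by
        rw [hC'.lt_iff, hj]
        exact h.asymm
      have h2 : b' j < k := hj ▸ hC'.b_lt_c j
      rw [← (ih _ h2 j).1.2 rfl, hC.lt_iff, hi] at h1
      rcases (not_lt.1 h1).lt_or_eq with h3 | h3
      · exact absurd (hj ▸ ((ih _ h3 j).2.1 rfl)) h3.ne'
      · exact absurd (hi.trans h3.symm) (hC.b_ne_c i j)

/-- Minima are shared and medians are excluded by `b_eq_of_below` with the roles exchanged, so `k`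
is a maximum of the second configuration; monotonicity then fixes its index. -/
theorem c_eq_of_below (hC : IsConfig a b c) (hC' : IsConfig a b' c') {k : α}
    (ih : ∀ m < k, ∀ i, (b i = m ↔ b' i = m) ∧ (c i = m ↔ c' i = m)) {i : Fin n} (hi : c i = k) :
    c' i = k := by
  rcases hC'.cover k with ⟨j, hj⟩ | ⟨j, hj⟩ | ⟨j, hj⟩
  · exact absurd (hj.trans hi.symm) (hC.a_ne_c j i)
  · have ih' : ∀ m < k, ∀ i, (b' i = m ↔ b i = m) ∧ (c' i = m ↔ c i = m) :=
      fun m hm i => ⟨(ih m hm i).1.symm, (ih m hm i).2.symm⟩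
    exact absurd ((b_eq_of_below hC' hC ih' hj).trans hi.symm) (hC.b_ne_c j i)
  · rcases lt_trichotomy i j with h | rfl | h
    · have h1 : c' i < k := hj ▸ hC'.c_mono h
      exact absurd (hi ▸ ((ih _ h1 i).2.2 rfl)) h1.ne'
    · exact hj
    · have h1 : c j < k := hi ▸ hC.c_mono h
      exact absurd (hj ▸ ((ih _ h1 j).2.1 rfl)) h1.ne'

/-- A configuration is determined by its minima. -/
theorem unique [WellFoundedLT α] (hC : IsConfig a b c) (hC' : IsConfig a b' c') :
    b = b' ∧ c = c' := by
  have key : ∀ k, ∀ i, (b i = k ↔ b' i = k) ∧ (c i = k ↔ c' i = k) := by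
    intro k
    induction k using WellFoundedLT.induction with
    | ind k ih =>
      have ih' : ∀ m < k, ∀ i, (b' i = m ↔ b i = m) ∧ (c' i = m ↔ c i = m) :=
        fun m hm i => ⟨(ih m hm i).1.symm, (ih m hm i).2.symm⟩
      exact fun i => ⟨⟨hC.b_eq_of_below hC' ih, hC'.b_eq_of_below hC ih'⟩,
        ⟨hC.c_eq_of_below hC' ih, hC'.c_eq_of_below hC ih'⟩⟩
  exact ⟨funext fun i => ((key _ i).1.1 rfl).symm, funext fun i => ((key _ i).2.1 rfl).symm⟩

/-- The minima of a configuration on `Fin (3 * n)`, shifted to `{1, …, 3n}`. -/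
def minSet {n : ℕ} (a : Fin n → Fin (3 * n)) : Finset ℕ :=
  Finset.univ.image fun i => (a i : ℕ) + 1

theorem mem_minSet {n : ℕ} {a : Fin n → Fin (3 * n)} {k : ℕ} :
    k ∈ minSet a ↔ ∃ i, (a i : ℕ) + 1 = k := by
  simp [minSet]

/-- Points below `a i` lie in triples of smaller index, which have only `3 * i` points. -/
theorem le_three_mul {a b c : Fin n → Fin (3 * n)} (hC : IsConfig a b c) (i : Fin n) :
    (a i : ℕ) ≤ 3 * i := by
  have hsub : Finset.Iio (a i) ⊆
      (Finset.Iio i ×ˢ (Finset.univ : Finset (Fin 3))).image fun q => (![a, b, c] q.2) q.1 := by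
    intro k hk
    rw [Finset.mem_Iio] at hk
    simp only [Finset.mem_image, Finset.mem_product, Finset.mem_Iio, Finset.mem_univ, and_true]
    rcases hC.cover k with ⟨j, rfl⟩ | ⟨j, rfl⟩ | ⟨j, rfl⟩
    · exact ⟨(j, 0), hC.a_mono.lt_iff_lt.1 hk, rfl⟩
    · exact ⟨(j, 1), hC.a_mono.lt_iff_lt.1 ((hC.a_lt_b j).trans hk), rfl⟩
    · exact ⟨(j, 2), hC.a_mono.lt_iff_lt.1 (((hC.a_lt_b j).trans (hC.b_lt_c j)).trans hk), rfl⟩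
  have := (Finset.card_le_card hsub).trans Finset.card_image_le
  rw [Finset.card_product] at this
  simp at this
  omega

theorem minSet_mem_TSets {a b c : Fin n → Fin (3 * n)} (hC : IsConfig a b c) :
    minSet a ∈ TSets n := by
  have hinj : StrictMono fun i => (a i : ℕ) + 1 := fun i j h => by
    have := hC.a_mono h
    simpa using this
  have hcard : (minSet a).card = n := by
    rw [minSet, Finset.card_image_of_injective _ hinj.injective]
    simp
  rw [TSets, Finset.mem_filter, Finset.mem_powersetCard]
  refine ⟨⟨fun k hk => ?_, hcard⟩, hcard, fun i => ?_⟩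
  · obtain ⟨i, rfl⟩ := mem_minSet.1 hk
    rw [Finset.mem_Icc]
    have := (a i).2
    omega
  · have h := Finset.orderEmbOfFin_unique hcard (f := fun i => (a i : ℕ) + 1)
      (fun i => mem_minSet.2 ⟨i, rfl⟩) hinj
    rw [← congrFun h i]
    have := hC.le_three_mul i
    omega

theorem minSet_injOn {a a' : Fin n → Fin (3 * n)} (ha : StrictMono a) (ha' : StrictMono a')
    (h : minSet a = minSet a') : a = a' := by
  rw [← ha.range_inj ha']
  ext k
  have := congrArg (fun T => (k : ℕ) + 1 ∈ T) h
  simpa [mem_minSet, Fin.ext_iff] using this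

/-! ### Blocks and the number of orientations -/

/-- The indices at which a block of overlapping intervals `[b i, c i]` ends. -/
def blockEnds {n : ℕ} {α : Type*} [LinearOrder α] (b c : Fin n → α) : Finset (Fin n) :=
  Finset.univ.filter fun i => ∀ j, i < j → c i < b j

theorem mem_blockEnds {i : Fin n} : i ∈ blockEnds b c ↔ ∀ j, i < j → c i < b j := by
  simp [blockEnds]

/-- Every block of a configuration can be oriented independently. -/
theorem ncard_isOrientation (hC : IsConfig a b c) :
    {s | IsOrientation b c s}.ncard = 2 ^ (blockEnds b c).card := by
  have hne : ∀ i : Fin n, ((blockEnds b c).filter (i ≤ ·)).Nonempty := by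
    intro i
    have : 0 < n := i.pos
    refine ⟨⟨n - 1, by omega⟩, ?_⟩
    rw [Finset.mem_filter, mem_blockEnds]
    refine ⟨fun j hj => ?_, ?_⟩
    · have := j.2
      simp only [Fin.lt_def] at hj
      omega
    · simp only [Fin.le_def]
      omega
  -- The end of the block containing `i`; it exists because the last index is vacuously a block end.
  let e : Fin n → Fin n := fun i => Finset.min' _ (hne i)
  have e_mem : ∀ i, e i ∈ blockEnds b c ∧ i ≤ e i := fun i =>
    Finset.mem_filter.1 (Finset.min'_mem _ (hne i))
  have e_le : ∀ i j, j ∈ blockEnds b c → i ≤ j → e i ≤ j := fun i j h1 h2 =>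
    Finset.min'_le _ _ (by simp [h1, h2])
  have e_self : ∀ i ∈ blockEnds b c, e i = i := fun i hi =>
    le_antisymm (e_le i i hi le_rfl) (e_mem i).2
  have hs : ∀ s, IsOrientation b c s → ∀ i, s i = s (e i) := by
    intro s hs i
    -- A change of orientation before `e i` would create an earlier block end.
    have step : ∀ d (hd : i + d ≤ (e i : ℕ)), s ⟨i + d, by omega⟩ = s i := by
      intro d
      induction d with
      | zero => intro _; rfl
      | succ d ih =>
        intro hd
        rw [← ih (by omega)]
        by_contra hne
        have h1 := hs ⟨i + d, by omega⟩ ⟨i + (d + 1), by omega⟩ (by simp [Fin.lt_def])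
          (fun h => hne h.symm)
        have h2 : (⟨i + d, by omega⟩ : Fin n) ∈ blockEnds b c := mem_blockEnds.2 fun j hj =>
          h1.trans_le (hC.b_mono.monotone hj)
        have h3 := e_le i _ h2 (by simp [Fin.le_def])
        simp only [Fin.le_def] at h3
        omega
    have hle : (i : ℕ) ≤ e i := (e_mem i).2
    have := step (e i - i) (by omega)
    rw [← this]
    congr 1
    ext
    simp only
    omega
  have hconv : ∀ s : Fin n → Bool, (∀ i, s i = s (e i)) → IsOrientation b c s := by
    intro s hs i j hij hne
    have h1 : e i < j := by
      by_contra h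
      have h2 : e j ≤ e i := e_le _ _ (e_mem i).1 (not_lt.1 h)
      have h3 : e i ≤ e j := e_le _ _ (e_mem j).1 (hij.le.trans (e_mem j).2)
      exact hne (by rw [hs i, hs j, le_antisymm h2 h3])
    exact (hC.c_mono.monotone (e_mem i).2).trans_lt (mem_blockEnds.1 (e_mem i).1 j h1)
  let f : {s | IsOrientation b c s} → (blockEnds b c → Bool) := fun s i => s.1 i
  have hf : Function.Bijective f := by
    constructor
    · rintro ⟨s, h1⟩ ⟨t, h2⟩ h
      ext i
      simp only
      rw [hs s h1, hs t h2]
      exact congrFun h ⟨e i, (e_mem i).1⟩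
    · intro g
      refine ⟨⟨fun i => g ⟨e i, (e_mem i).1⟩, hconv _ fun i => ?_⟩, ?_⟩
      · simp only [e_self _ (e_mem i).1]
      · ext ⟨i, hi⟩
        simp only [f, e_self i hi]
  rw [← Nat.card_coe_set_eq, Nat.card_eq_of_bijective f hf]
  simp

end IsConfig

end ThreeCycles

/-! ### Letter counts in the word -/

namespace ThreeCycles

theorem throughNth_append_cons (l : Letter) (u v : List Letter) :
    throughNth l (u.count l + 1) (u ++ l :: v) = u ++ [l] := by
  induction u with
  | nil => cases v <;> simp [throughNth]
  | cons m u ih =>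
    by_cases h : m = l
    · subst h
      simp [throughNth, ih]
    · simp [throughNth, h, ih]

/-- The letter of `W(T)` in the (zero-based) position `k`. -/
def letterAt (T : Finset ℕ) (k : ℕ) : Letter := nextLetter T (k + 1) (wordPrefix T k)

/-- The number of occurrences of the letter `l` among the first `k` letters of `W(T)`. -/
def letterCount (T : Finset ℕ) (l : Letter) (k : ℕ) : ℕ := Nat.count (fun m => letterAt T m = l) k

variable {T : Finset ℕ}

theorem count_wordPrefix (l : Letter) (k : ℕ) : (wordPrefix T k).count l = letterCount T l k := by
  induction k with
  | zero => rfl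
  | succ k ih =>
    rw [wordPrefix, List.count_append, ih, letterCount, letterCount, Nat.count_succ]
    change _ + [letterAt T k].count l = _
    rw [List.count_singleton]
    simp

theorem wordPrefix_eq_append {p k : ℕ} (h : p < k) :
    ∃ v, wordPrefix T k = wordPrefix T p ++ letterAt T p :: v := by
  induction k with
  | zero => omega
  | succ k ih =>
    rcases Nat.lt_succ_iff_lt_or_eq.1 h with h | rfl
    · obtain ⟨v, hv⟩ := ih h
      exact ⟨v ++ [letterAt T k], by rw [wordPrefix, hv]; simp [letterAt, hv]⟩
    · exact ⟨[], rfl⟩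

theorem throughNth_wordPrefix {l : Letter} {p k : ℕ} (h : p < k) (hp : letterAt T p = l) :
    throughNth l (letterCount T l p + 1) (wordPrefix T k) = wordPrefix T (p + 1) := by
  obtain ⟨v, hv⟩ := wordPrefix_eq_append (T := T) h
  rw [hv, hp, ← count_wordPrefix, throughNth_append_cons, ← hp]
  rfl

theorem letterCount_succ (l : Letter) (k : ℕ) :
    letterCount T l (k + 1) = letterCount T l k + if letterAt T k = l then 1 else 0 :=
  Nat.count_succ _ _

theorem letterCount_mono (l : Letter) {k m : ℕ} (h : k ≤ m) :
    letterCount T l k ≤ letterCount T l m := Nat.count_monotone _ h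

theorem letterCount_lt {l : Letter} {k m : ℕ} (hk : letterAt T k = l) (h : k < m) :
    letterCount T l k < letterCount T l m := Nat.count_strict_mono hk h

theorem lt_iff_lt_letterCount {l : Letter} {k m : ℕ} (hk : letterAt T k = l) :
    k < m ↔ letterCount T l k < letterCount T l m :=
  ⟨letterCount_lt hk, fun h => by
    by_contra hle
    exact absurd (letterCount_mono l (not_lt.1 hle)) (not_le.2 h)⟩

theorem exists_letterCount_eq {l : Letter} {i k : ℕ} (h : i < letterCount T l k) :
    ∃ p < k, letterAt T p = l ∧ letterCount T l p = i := by
  induction k with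
  | zero => simp [letterCount] at h
  | succ k ih =>
    by_cases h' : i < letterCount T l k
    · obtain ⟨p, hp, h⟩ := ih h'
      exact ⟨p, by omega, h⟩
    · rw [letterCount_succ] at h
      split_ifs at h with hk
      · exact ⟨k, by omega, hk, by omega⟩
      · omega

theorem letterCount_add (k : ℕ) :
    letterCount T .x k + letterCount T .y k + letterCount T .z k = k := by
  induction k with
  | zero => rfl
  | succ k ih =>
    simp only [letterCount_succ]
    cases letterAt T k <;> simp <;> omega

theorem zBeforeX_wordPrefix {p k : ℕ} (h : p < k) (hp : letterAt T p = .x) :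
    zBeforeX (wordPrefix T k) (letterCount T .x p + 1) = letterCount T .z p := by
  rw [zBeforeX, throughNth_wordPrefix h hp, count_wordPrefix, letterCount_succ, hp]
  simp

theorem letterAt_eq_z_iff {k : ℕ} : letterAt T k = .z ↔ k + 1 ∈ T := by
  unfold letterAt nextLetter
  split_ifs <;> simp_all

theorem letterAt_of_count_eq {k : ℕ} (hk : k + 1 ∉ T)
    (h : letterCount T .x k = letterCount T .y k) : letterAt T k = .x := by
  unfold letterAt nextLetter X Y
  simp only [count_wordPrefix]
  simp [hk, h]

theorem letterAt_of_count_ne {k p : ℕ} (hk : k + 1 ∉ T) (hp : p < k) (hpx : letterAt T p = .x)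
    (hpk : letterCount T .x p = letterCount T .y k)
    (h : letterCount T .x k ≠ letterCount T .y k) :
    letterAt T k = if letterCount T .z p = letterCount T .x k then .y else .x := by
  conv_lhs => unfold letterAt nextLetter X Y
  simp only [count_wordPrefix]
  rw [← hpk, zBeforeX_wordPrefix hp hpx, hpk]
  simp [hk, h]

/-- The invariant that governs the construction of `W(T)`. -/
theorem letterCount_invariant {N : ℕ}
    (hT : ∀ k < N, k + 1 ∉ T → k + 1 ≤ 3 * letterCount T .z k) {k : ℕ} (hk : k ≤ N) :
    letterCount T .y k ≤ letterCount T .x k ∧ ∀ p < k, letterAt T p = .x →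
      letterCount T .x p = letterCount T .y k → letterCount T .x k ≤ letterCount T .z p := by
  induction k with
  | zero => simp [letterCount]
  | succ k ih =>
    obtain ⟨h1, h2⟩ := ih (by omega)
    have hadd := letterCount_add (T := T) k
    by_cases hz : k + 1 ∈ T
    · have hl := letterAt_eq_z_iff.2 hz
      simp only [letterCount_succ, hl]
      simp only [reduceCtorEq, if_false, add_zero]
      refine ⟨h1, fun p hp hpx => h2 p ?_ hpx⟩
      rcases Nat.lt_succ_iff_lt_or_eq.1 hp with h | rfl
      · exact h
      · simp [hl] at hpx
    have hzk := hT k (by omega) hz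
    -- When X = Y, the bound k + 1 ≤ 3Z with k = 2X + Z gives X < Z, leaving room for a new `x`.
    by_cases heq : letterCount T .x k = letterCount T .y k
    · have hl := letterAt_of_count_eq hz heq
      simp only [letterCount_succ, hl]
      simp only [reduceCtorEq, if_false, add_zero, if_true]
      refine ⟨by omega, fun p hp hpx hpc => ?_⟩
      rcases Nat.lt_succ_iff_lt_or_eq.1 hp with h | rfl
      · have := letterCount_lt hpx h
        omega
      · omega
    · obtain ⟨q, hq, hqx, hqc⟩ := exists_letterCount_eq (lt_of_le_of_ne h1 (Ne.symm heq))
      have hl := letterAt_of_count_ne hz hq hqx hqc heq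
      have hqz := h2 q hq hqx hqc
      split_ifs at hl with hc
      · simp only [letterCount_succ, hl]
        simp only [reduceCtorEq, if_false, add_zero, if_true]
        -- The `x` to be matched is now a later one than `q`, with at least as many `z`'s before it.
        refine ⟨by omega, fun p hp hpx hpc => ?_⟩
        have : q < p := (lt_iff_lt_letterCount hqx).2 (by omega)
        have := letterCount_mono (T := T) .z this.le
        omega
      -- The bound at `q` is strict here, so one more `x` fits.
      · simp only [letterCount_succ, hl]
        simp only [reduceCtorEq, if_false, add_zero, if_true]
        refine ⟨by omega, fun p hp hpx hpc => ?_⟩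
        rcases Nat.lt_succ_iff_lt_or_eq.1 hp with h | rfl
        · have h5 : ¬ q < p := fun h => by have := letterCount_lt hqx h; omega
          have h6 : ¬ p < q := fun h => by have := letterCount_lt hpx h; omega
          obtain rfl : p = q := by omega
          omega
        · omega

/-- At a letter `y`, the number of `x`'s is the number of `z`'s before the corresponding `x`. -/
theorem letterCount_of_letterAt_y {k : ℕ} (hk : letterAt T k = .y)
    (hle : letterCount T .y k ≤ letterCount T .x k) :
    letterCount T .y k < letterCount T .x k ∧ ∀ p < k, letterAt T p = .x →
      letterCount T .x p = letterCount T .y k → letterCount T .z p = letterCount T .x k := by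
  have hz : k + 1 ∉ T := fun h => by simp [letterAt_eq_z_iff.2 h] at hk
  have hne : letterCount T .x k ≠ letterCount T .y k := fun h => by
    simp [letterAt_of_count_eq hz h] at hk
  refine ⟨by omega, fun p hp hpx hpc => ?_⟩
  have := letterAt_of_count_ne hz hp hpx hpc hne
  by_contra h
  simp [h, hk] at this

theorem letterCount_z (k : ℕ) (h0 : 0 ∉ T) :
    letterCount T .z k = (T.filter (· ≤ k)).card := by
  induction k with
  | zero =>
    symm
    simp only [letterCount, Nat.count_zero, Finset.card_eq_zero, Finset.filter_eq_empty_iff]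
    intro m hm h
    exact h0 (by rwa [Nat.le_zero.1 h] at hm)
  | succ k ih =>
    rw [letterCount_succ, ih]
    have hE : T.filter (· ≤ k + 1) = T.filter (· ≤ k) ∪ T.filter (· = k + 1) := by
      ext m
      simp only [Finset.mem_filter, Finset.mem_union, ← and_or_left]
      constructor <;> rintro ⟨h1, h2⟩ <;> exact ⟨h1, by omega⟩
    rw [hE, Finset.card_union_of_disjoint, Finset.filter_eq']
    · congr 1
      by_cases h : k + 1 ∈ T
      · simp [h, letterAt_eq_z_iff.2 h]
      · simp [h, letterAt_eq_z_iff]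
    · rw [Finset.disjoint_filter]
      intro m _ h
      omega

theorem letterCount_z_of_mem_TSets {n : ℕ} (hT : T ∈ TSets n) :
    letterCount T .z (3 * n) = n ∧
      ∀ k < 3 * n, k + 1 ∉ T → k + 1 ≤ 3 * letterCount T .z k := by
  rw [TSets, Finset.mem_filter, Finset.mem_powersetCard] at hT
  obtain ⟨⟨hsub, -⟩, hcard, hle⟩ := hT
  have h0 : 0 ∉ T := fun h => by simpa using hsub h
  constructor
  · rw [letterCount_z _ h0, Finset.filter_true_of_mem, hcard]
    intro m hm
    exact (Finset.mem_Icc.1 (hsub hm)).2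
  · intro k hk hkT
    by_contra hlt
    have hi : letterCount T .z k < n := by omega
    -- With Z the count at `k`, the element of zero-based index Z is at most 3Z + 1 ≤ k + 1 and is
    -- not k + 1, so more than Z elements would be at most `k`.
    have ht := hle ⟨_, hi⟩
    have hmem := T.orderEmbOfFin_mem hcard ⟨_, hi⟩
    have hne : T.orderEmbOfFin hcard ⟨_, hi⟩ ≠ k + 1 := fun h => hkT (h ▸ hmem)
    simp only at ht
    have hsub : (Finset.Iic (⟨_, hi⟩ : Fin n)).map (T.orderEmbOfFin hcard).toEmbedding ⊆
        T.filter (· ≤ k) := by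
      intro m hm
      obtain ⟨j, hj, rfl⟩ := Finset.mem_map.1 hm
      have := (T.orderEmbOfFin hcard).monotone (Finset.mem_Iic.1 hj)
      rw [Finset.mem_filter]
      refine ⟨T.orderEmbOfFin_mem hcard j, ?_⟩
      simp only [RelEmbedding.coe_toEmbedding]
      omega
    have := Finset.card_le_card hsub
    rw [← letterCount_z _ h0] at this
    simp at this

/-! ### From admissible sets to configurations -/

/-- Every admissible set `T` is the set of minima of a configuration. -/
theorem exists_isConfig_of_mem_TSets {n : ℕ} (hT : T ∈ TSets n) :
    ∃ a b c : Fin n → Fin (3 * n), IsConfig a b c ∧ IsConfig.minSet a = T ∧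
      (IsConfig.blockEnds b c).card = h n T := by
  obtain ⟨hz, hT'⟩ := letterCount_z_of_mem_TSets hT
  have hinv := fun {k : ℕ} (hk : k ≤ 3 * n) => letterCount_invariant hT' hk
  have hadd := letterCount_add (T := T) (3 * n)
  -- Here X + Y = 2n; if Y < X, the invariant gives X ≤ n, a contradiction.
  have hx : letterCount T .x (3 * n) = n := by
    obtain ⟨h1, h2⟩ := hinv le_rfl
    rcases h1.lt_or_eq with h3 | h3
    · obtain ⟨p, hp, hpx, hpc⟩ := exists_letterCount_eq h3
      have := h2 p hp hpx hpc
      have := letterCount_mono (T := T) .z hp.le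
      omega
    · omega
  have hy : letterCount T .y (3 * n) = n := by omega
  have hex : ∀ l, letterCount T l (3 * n) = n → ∃ f : Fin n → Fin (3 * n), ∀ i,
      letterAt T (f i) = l ∧ letterCount T l (f i) = i := by
    intro l hl
    have : ∀ i : Fin n, ∃ p : Fin (3 * n), letterAt T p = l ∧ letterCount T l p = i := by
      intro i
      obtain ⟨p, hp, h⟩ := exists_letterCount_eq (T := T) (l := l) (i := i) (by rw [hl]; exact i.2)
      exact ⟨⟨p, hp⟩, h⟩
    choose f hf using this
    exact ⟨f, hf⟩
  obtain ⟨a, ha⟩ := hex .z hz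
  obtain ⟨b, hb⟩ := hex .x hx
  obtain ⟨c, hc⟩ := hex .y hy
  have mono : ∀ l (f : Fin n → Fin (3 * n)), (∀ i, letterAt T (f i) = l ∧
      letterCount T l (f i) = i) → StrictMono f := by
    intro l f hf i j hij
    rw [Fin.lt_def, lt_iff_lt_letterCount (hf i).1, (hf i).2, (hf j).2]
    exact hij
  have onto : ∀ l (f : Fin n → Fin (3 * n)), letterCount T l (3 * n) = n → (∀ i,
      letterAt T (f i) = l ∧ letterCount T l (f i) = i) →
      ∀ k : Fin (3 * n), letterAt T k = l → ∃ i, f i = k := by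
    intro l f hl hf k hk
    have h1 := letterCount_lt hk k.2
    rw [hl] at h1
    refine ⟨⟨_, h1⟩, ?_⟩
    have h2 := (hf ⟨_, h1⟩).2
    have h3 := lt_iff_lt_letterCount (m := k) (hf ⟨_, h1⟩).1
    have h4 := lt_iff_lt_letterCount (m := f ⟨_, h1⟩) hk
    simp only at h2
    ext
    omega
  have a_lt : ∀ i k, (a i : ℕ) < k ↔ (i : ℕ) < letterCount T .z k := fun i k => by
    rw [lt_iff_lt_letterCount (ha i).1, (ha i).2]
  have b_lt : ∀ i k, (b i : ℕ) < k ↔ (i : ℕ) < letterCount T .x k := fun i k => by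
    rw [lt_iff_lt_letterCount (hb i).1, (hb i).2]
  have hcy := fun j => letterCount_of_letterAt_y (hc j).1 (hinv (c j).2.le).1
  have b_lt_c : ∀ i, b i < c i := fun i => by
    rw [Fin.lt_def, b_lt, ← (hc i).2]
    exact (hcy i).1
  -- Each side bounds `i` by a count: `z`'s before `b j`, respectively `x`'s before `c j`. The rule
  -- for `y` makes the counts equal.
  have lt_iff : ∀ i j, a i < b j ↔ b i < c j := fun i j => by
    rw [Fin.lt_def, Fin.lt_def, a_lt, b_lt,
      (hcy j).2 (b j) (b_lt_c j) (hb j).1 ((hb j).2.trans (hc j).2.symm)]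
  refine ⟨a, b, c, ⟨mono _ _ ha, mono _ _ hb, mono _ _ hc, fun i => (lt_iff i i).2 (b_lt_c i),
    b_lt_c, lt_iff, fun i j h => ?_, fun i j h => ?_, fun i j h => ?_, fun k => ?_⟩, ?_, ?_⟩
  · have := (ha i).1; rw [h, (hb j).1] at this; cases this
  · have := (ha i).1; rw [h, (hc j).1] at this; cases this
  · have := (hb i).1; rw [h, (hc j).1] at this; cases this
  · cases hk : letterAt T k
    · exact Or.inr (Or.inl (onto _ _ hx hb k hk))
    · exact Or.inr (Or.inr (onto _ _ hy hc k hk))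
    · exact Or.inl (onto _ _ hz ha k hk)
  · have hsub : T ⊆ Finset.Icc 1 (3 * n) := (Finset.mem_powersetCard.1 (Finset.mem_filter.1 hT).1).1
    ext k
    rw [IsConfig.mem_minSet]
    constructor
    · rintro ⟨i, rfl⟩
      exact letterAt_eq_z_iff.1 (ha i).1
    · intro hk
      have hk' := Finset.mem_Icc.1 (hsub hk)
      obtain ⟨i, hi⟩ := onto _ _ hz ha ⟨k - 1, by omega⟩
        (letterAt_eq_z_iff.2 (by simpa [Nat.sub_add_cancel hk'.1] using hk))
      exact ⟨i, by rw [hi]; simp only; omega⟩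
  · have hseg : ∀ j : Fin n, X (initialSegment (W n T) (j + 1)) = letterCount T .x (c j) := by
      intro j
      have := throughNth_wordPrefix (c j).2 (hc j).1
      rw [(hc j).2] at this
      rw [initialSegment, W, this, X, count_wordPrefix, letterCount_succ, (hc j).1]
      simp
    -- At least `j + 1` medians precede `c j`; equality says that the next median, if any, comes
    -- after it.
    have hend : ∀ j : Fin n, j ∈ IsConfig.blockEnds b c ↔ letterCount T .x (c j) = j + 1 := by
      intro j
      have h1 := (hcy j).1
      rw [(hc j).2] at h1
      have h2 := letterCount_mono (T := T) .x (c j).2.le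
      rw [IsConfig.mem_blockEnds]
      constructor
      · intro h
        by_contra hne
        have h4 : (j : ℕ) + 1 < n := by omega
        have h3 := h ⟨j + 1, h4⟩ (by simp [Fin.lt_def])
        exact h3.asymm (Fin.lt_def.2 ((b_lt _ _).2 (by simp only; omega)))
      · intro h i hij
        have h3 : ¬ (b i : ℕ) < c j := by
          rw [b_lt, h]
          have := Fin.lt_def.1 hij
          omega
        have h4 : (b i : ℕ) ≠ c j := fun e => by
          have := (hb i).1; rw [e, (hc j).1] at this; cases this
        rw [Fin.lt_def]
        omega
    have hYW : Y (W n T) = n := by rw [Y, W, count_wordPrefix, hy]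
    rw [h, hYW]
    refine Finset.card_bij (fun j _ => (j : ℕ) + 1) ?_ ?_ ?_
    · intro j hj
      rw [Finset.mem_filter, Finset.mem_Icc, hseg]
      have := j.2
      exact ⟨by omega, (hend j).1 hj⟩
    · intro i _ j _ hij
      ext
      omega
    · intro k hk
      rw [Finset.mem_filter, Finset.mem_Icc] at hk
      obtain ⟨m, rfl⟩ : ∃ m, k = m + 1 := ⟨k - 1, by omega⟩
      refine ⟨⟨m, by omega⟩, ?_, rfl⟩
      rw [hend, ← hseg]
      exact hk.2

end ThreeCycles

/-! ### Fibers of the map to cycle minima -/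

namespace ThreeCycles

/-- The minima of the three-cycles of `π`, shifted to `{1, …, 3n}`. -/
def cycleMinima {n : ℕ} (π : Equiv.Perm (Fin (3 * n))) : Finset ℕ :=
  (Finset.univ.filter fun p => p < π p ∧ p < π (π p)).image fun p : Fin (3 * n) => (p : ℕ) + 1

theorem IsConfig.cycleMinima_eq {n : ℕ} {a b c : Fin n → Fin (3 * n)} (hC : IsConfig a b c)
    {s : Fin n → Bool} {π : Equiv.Perm (Fin (3 * n))} (hs : Realizes a b c s π) :
    cycleMinima π = minSet a := by
  ext k
  simp [cycleMinima, mem_minSet, hC.realizes_min_iff hs]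

/-- A permutation with these minima comes from a configuration with the same `a`, hence from this
one by `unique`; only the orientation is free. -/
theorem IsConfig.ncard_fiber {n : ℕ} {a b c : Fin n → Fin (3 * n)} (hC : IsConfig a b c) :
    {π | π ∈ AvStar n pattern321 ∧ cycleMinima π = minSet a}.ncard =
      2 ^ (blockEnds b c).card := by
  choose perm hperm using hC.exists_realizes
  rw [← hC.ncard_isOrientation, eq_comm]
  refine Set.ncard_congr (fun s _ => perm s) ?_ ?_ ?_
  · intro s hs
    exact ⟨hC.mem_avStar hs (hperm s), hC.cycleMinima_eq (hperm s)⟩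
  · intro s t _ _ h
    exact hC.realizes_unique_orientation (hperm s) (h ▸ hperm t)
  · rintro π ⟨hπ, hmin⟩
    obtain ⟨a', b', c', s, hC', hO, hs⟩ := exists_isConfig_of_mem_avStar hπ
    rw [hC'.cycleMinima_eq hs] at hmin
    obtain rfl := minSet_injOn hC'.a_mono hC.a_mono hmin
    obtain ⟨rfl, rfl⟩ := hC'.unique hC
    exact ⟨s, hO, hC.realizes_unique_perm (hperm s) hs⟩

end ThreeCycles

theorem mainTheorem5 (n : ℕ) (hn : 1 ≤ n) :
    (ThreeCycles.AvStar n ThreeCycles.pattern321).ncard =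
      ∑ T ∈ ThreeCycles.TSets n, 2 ^ ThreeCycles.h n T := by
  classical
  have hfin := Set.toFinite (ThreeCycles.AvStar n ThreeCycles.pattern321)
  rw [Set.ncard_eq_toFinset_card _ hfin,
    Finset.card_eq_sum_card_fiberwise (f := ThreeCycles.cycleMinima) (t := ThreeCycles.TSets n)]
  · refine Finset.sum_congr rfl fun T hT => ?_
    obtain ⟨a, b, c, hC, rfl, hcard⟩ := ThreeCycles.exists_isConfig_of_mem_TSets hT
    rw [← hcard, ← hC.ncard_fiber, ← Set.ncard_coe_finset]
    congr 1
    ext π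
    simp
  · intro π hπ
    obtain ⟨a, b, c, s, hC, -, hs⟩ :=
      ThreeCycles.exists_isConfig_of_mem_avStar (hfin.mem_toFinset.1 hπ)
    rw [hC.cycleMinima_eq hs]
    exact hC.minSet_mem_TSets
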